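/- Let $k$ be an algebraically closed field of characteristic zero and let $V$ be a $k$-vector space of finite dimension $d\neq 2$. Let $\mathcal M=\mathrm{Hom}_k(V\otimes V,V)$ be the affine space of all multiplication laws on $V$ (not necessarily associative or unital). For $m\in\mathcal M$, a subspace $I\subseteq V$ is a left (right) ideal of the algebra $(V,m)$ if $m(V,I)\subseteq I$ (respectively $m(I,V)\subseteq I$), and $(V,m)$ is left-simple (right-simple) if it has no left (right) ideals other than $0$ and $V$. Algebras $(V,m)$ and $(V,m')$ are isotopic, and $(V,m')$ is called an isotope of $(V,m)$, if there are $f_1,f_2,f_3\in GL(V)$ with $f_1(m(x,y))=m'(f_2(x),f_3(y))$ for all $x,y\in V$. Then a generic algebra structure on $V$ is isotopically left-simple and isotopically right-simple: there is a Zariski-open dense subset $U\subseteq\mathcal M$ such that for every $m\in U$ every isotope of $(V,m)$ is both left-simple and right-simple. -/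

import Mathlib

/-- The polynomial functions on a `k`-vector space `W`: the subalgebra of all functions `W → k`
generated by the linear forms. -/
def polyFunctionsOn (k W : Type*) [Field k] [AddCommGroup W] [Module k W] :
    Subalgebra k (W → k) :=
  Algebra.adjoin k (Set.range fun φ : Module.Dual k W => (φ : W → k))

/-- The common zero set of a set of functions. -/
def commonZeros {k W : Type*} [Field k] (P : Set (W → k)) : Set W :=
  {w | ∀ p ∈ P, p w = 0}

/-- A set is Zariski closed if it is the common zero set of some set of polynomial functions. -/
def IsZariskiClosed (k : Type*) {W : Type*} [Field k] [AddCommGroup W] [Module k W]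
    (Z : Set W) : Prop :=
  ∃ P : Set (W → k), P ⊆ (polyFunctionsOn k W : Set (W → k)) ∧ Z = commonZeros P

theorem isZariskiClosed_empty (k W : Type*) [Field k] [AddCommGroup W] [Module k W] :
    IsZariskiClosed k (∅ : Set W) := by
  refine ⟨{1}, ?_, ?_⟩
  · intro p hp
    rw [Set.mem_singleton_iff.mp hp]
    exact one_mem (polyFunctionsOn k W)
  · ext w
    simp [commonZeros]

theorem isZariskiClosed_sInter (k W : Type*) [Field k] [AddCommGroup W] [Module k W]
    (A : Set (Set W)) (hA : ∀ Z ∈ A, IsZariskiClosed k Z) : IsZariskiClosed k (⋂₀ A) := by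
  refine ⟨{p | p ∈ polyFunctionsOn k W ∧ ∃ Z ∈ A, ∀ w ∈ Z, p w = 0}, fun p hp => hp.1, ?_⟩
  ext w
  constructor
  · rintro hw p ⟨-, Z, hZ, hp⟩
    exact hp w (hw Z hZ)
  · intro hw Z hZ
    obtain ⟨P, hP, rfl⟩ := hA Z hZ
    exact fun p hp => hw p ⟨hP hp, _, hZ, fun v hv => hv p hp⟩

theorem isZariskiClosed_union (k W : Type*) [Field k] [AddCommGroup W] [Module k W]
    (Y Z : Set W) (hY : IsZariskiClosed k Y) (hZ : IsZariskiClosed k Z) :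
    IsZariskiClosed k (Y ∪ Z) := by
  obtain ⟨P, hP, rfl⟩ := hY
  obtain ⟨Q, hQ, rfl⟩ := hZ
  refine ⟨{r | ∃ p ∈ P, ∃ q ∈ Q, r = p * q}, ?_, ?_⟩
  · rintro r ⟨p, hp, q, hq, rfl⟩
    exact mul_mem (hP hp) (hQ hq)
  · ext w
    constructor
    · rintro (hw | hw) r ⟨p, hp, q, hq, rfl⟩
      · simp [hw p hp]
      · simp [hw q hq]
    · intro hw
      by_contra hcon
      simp only [Set.mem_union, commonZeros, Set.mem_ofPred_eq, not_or, not_forall] at hcon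
      obtain ⟨⟨p, hp, hpw⟩, ⟨q, hq, hqw⟩⟩ := hcon
      exact mul_ne_zero hpw hqw (hw (p * q) ⟨p, hp, q, hq, rfl⟩)

/-- The Zariski topology on (the `k`-points of) a `k`-vector space `W`. -/
@[reducible]
def zariskiTopology (k W : Type*) [Field k] [AddCommGroup W] [Module k W] :
    TopologicalSpace W :=
  TopologicalSpace.ofClosed {Z : Set W | IsZariskiClosed k Z} (isZariskiClosed_empty k W)
    (fun A hA => isZariskiClosed_sInter k W A fun _ hZ => hA hZ)
    (fun Y hY Z hZ => isZariskiClosed_union k W Y Z hY hZ)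

/-- A property holds for a generic element of `W` if it holds at all points of some
Zariski open dense subset of `W`. -/
def HoldsGenerically (k : Type*) {W : Type*} [Field k] [AddCommGroup W] [Module k W]
    (p : W → Prop) : Prop :=
  ∃ U : Set W, @IsOpen W (zariskiTopology k W) U ∧ @Dense W (zariskiTopology k W) U ∧ ∀ w ∈ U, p w

section Algebras

variable {k V : Type*} [Field k] [AddCommGroup V] [Module k V]

/-- A multiplication law on `V`, not necessarily associative or unital: a bilinear map
`V × V → V`, that is, an element of `Hom(V ⊗ V, V)`. -/
abbrev MultiplicationLaw (k V : Type*) [Field k] [AddCommGroup V] [Module k V] : Type _ :=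
  V →ₗ[k] V →ₗ[k] V

/-- A subspace `I` is a left ideal of `(V, m)` if `m(V, I) ⊆ I`. -/
def IsLeftIdealOf (m : MultiplicationLaw k V) (I : Submodule k V) : Prop :=
  ∀ v : V, ∀ x ∈ I, m v x ∈ I

/-- A subspace `I` is a right ideal of `(V, m)` if `m(I, V) ⊆ I`. -/
def IsRightIdealOf (m : MultiplicationLaw k V) (I : Submodule k V) : Prop :=
  ∀ v : V, ∀ x ∈ I, m x v ∈ I

/-- `(V, m)` has no left ideals other than `0` and `V`. -/
def IsLeftSimpleAlg (m : MultiplicationLaw k V) : Prop :=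
  ∀ I : Submodule k V, IsLeftIdealOf m I → I = ⊥ ∨ I = ⊤

/-- `(V, m)` has no right ideals other than `0` and `V`. -/
def IsRightSimpleAlg (m : MultiplicationLaw k V) : Prop :=
  ∀ I : Submodule k V, IsRightIdealOf m I → I = ⊥ ∨ I = ⊤

/-- `(V, m₁)` and `(V, m₂)` are isotopic. -/
def AreIsotopic (m₁ m₂ : MultiplicationLaw k V) : Prop :=
  ∃ f₁ f₂ f₃ : V ≃ₗ[k] V, ∀ x y : V, f₁ (m₁ x y) = m₂ (f₂ x) (f₃ y)

/-- Every isotope of `(V, m)` is left-simple. -/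
def IsIsotopicallyLeftSimple (m : MultiplicationLaw k V) : Prop :=
  ∀ m' : MultiplicationLaw k V, AreIsotopic m m' → IsLeftSimpleAlg m'

/-- Every isotope of `(V, m)` is right-simple. -/
def IsIsotopicallyRightSimple (m : MultiplicationLaw k V) : Prop :=
  ∀ m' : MultiplicationLaw k V, AreIsotopic m m' → IsRightSimpleAlg m'

end Algebras

/-! A left ideal of an isotope pulls back to subspaces `J`, `K` of equal dimension with m(V, J) ⊆ K.
Let A, B, C be left multiplications by three vectors. If A is invertible, then K = AJ, so J is
stable under A⁻¹B and A⁻¹C; if the words (A⁻¹B)ⁱ(A⁻¹C)(A⁻¹B)ʲ with i, j < d also span all matrices,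
J is 0 or V. Using the adjugate in place of A⁻¹ makes this condition the nonvanishing of one
polynomial, `wordDet`, so a single example makes it generic (`wordDet_one_diagonal_ne_zero`).
Prescribing A, B, C independently takes d ≥ 3; for d ≤ 1 there are no proper nonzero subspaces. The
right-handed case follows by flipping the law. -/

/-- The determinant of `A` times the determinant of the coefficients of the matrices
`(adj A * B) ^ i * (adj A * C) * (adj A * B) ^ j`. -/
noncomputable def wordDet {S : Type*} [CommRing S] {d : ℕ} (A B C : Matrix (Fin d) (Fin d) S) : S :=
  A.det * (Matrix.of fun p q : Fin d × Fin d =>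
    ((A.adjugate * B) ^ (p.1 : ℕ) * (A.adjugate * C) * (A.adjugate * B) ^ (p.2 : ℕ)) q.1 q.2).det

theorem map_wordDet {S T : Type*} [CommRing S] [CommRing T] {d : ℕ} (f : S →+* T)
    (A B C : Matrix (Fin d) (Fin d) S) :
    f (wordDet A B C) = wordDet (f.mapMatrix A) (f.mapMatrix B) (f.mapMatrix C) := by
  unfold wordDet
  rw [map_mul, RingHom.map_det, RingHom.map_det]
  congr 2
  ext p q
  simp only [← RingHom.map_adjugate, ← map_mul, ← map_pow]
  rfl

/-- Powers of a diagonal matrix with distinct entries and the all-ones matrix span all matrices. -/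
theorem wordDet_one_diagonal_ne_zero {k : Type*} [Field k] [CharZero k] (d : ℕ) :
    wordDet (1 : Matrix (Fin d) (Fin d) k) (Matrix.diagonal fun i => ((i : ℕ) : k))
      (Matrix.of fun _ _ => 1) ≠ 0 := by
  have hV : (Matrix.vandermonde fun i : Fin d => ((i : ℕ) : k)).det ≠ 0 :=
    Matrix.det_vandermonde_ne_zero_iff.mpr fun i j h => Fin.ext (Nat.cast_injective h)
  -- With D the diagonal matrix and E the all-ones matrix, the (i, j) entry of DᵖEDʳ is iᵖjʳ, whence
  -- a Kronecker product of Vandermonde matrices.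
  have hM : (Matrix.of fun p q : Fin d × Fin d =>
      ((Matrix.diagonal fun i : Fin d => ((i : ℕ) : k)) ^ (p.1 : ℕ) *
        (Matrix.of fun _ _ => 1 : Matrix (Fin d) (Fin d) k) *
        (Matrix.diagonal fun i : Fin d => ((i : ℕ) : k)) ^ (p.2 : ℕ)) q.1 q.2) =
      Matrix.kroneckerMap (· * ·) (Matrix.vandermonde fun i : Fin d => ((i : ℕ) : k)).transpose
        (Matrix.vandermonde fun i : Fin d => ((i : ℕ) : k)).transpose := by
    ext p q
    simp [Matrix.diagonal_pow, Matrix.vandermonde_apply]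
  simp only [wordDet, Matrix.adjugate_one, one_mul, Matrix.det_one]
  rw [hM, Matrix.det_kronecker, Matrix.det_transpose]
  exact mul_ne_zero (pow_ne_zero _ hV) (pow_ne_zero _ hV)

theorem Submodule.eq_bot_or_eq_top_of_forall_mulVec_mem {k ι : Type*} [Field k] [Fintype ι]
    (J : Submodule k (ι → k)) (h : ∀ (N : Matrix ι ι k), ∀ x ∈ J, N.mulVec x ∈ J) :
    J = ⊥ ∨ J = ⊤ := by
  classical
  refine or_iff_not_imp_left.mpr fun hJ => ?_
  obtain ⟨x, hx, hx0⟩ := J.ne_bot_iff.mp hJ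
  obtain ⟨i, hi⟩ := Function.ne_iff.mp hx0
  refine eq_top_iff.mpr fun y _ => ?_
  -- This rank-one matrix sends `x` to `y`.
  have := h (Matrix.vecMulVec y (Pi.single i (x i)⁻¹)) x hx
  rw [Matrix.vecMulVec_mulVec, single_dotProduct, inv_mul_cancel₀ hi] at this
  simpa using this

theorem Submodule.eq_bot_or_eq_top_of_wordDet_ne_zero {k : Type*} [Field k] {d : ℕ}
    {A B C : Matrix (Fin d) (Fin d) k} (h : wordDet A B C ≠ 0) (J K : Submodule k (Fin d → k))
    (hJK : Module.finrank k K ≤ Module.finrank k J) (hA : ∀ x ∈ J, A.mulVec x ∈ K)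
    (hB : ∀ x ∈ J, B.mulVec x ∈ K) (hC : ∀ x ∈ J, C.mulVec x ∈ K) : J = ⊥ ∨ J = ⊤ := by
  obtain ⟨hdet, hM⟩ := mul_ne_zero_iff.mp h
  have hAinj : Function.Injective A.mulVecLin :=
    Matrix.mulVec_injective_iff_isUnit.mpr ((Matrix.isUnit_iff_isUnit_det A).mpr hdet.isUnit)
  have hAJ : J.map A.mulVecLin = K := by
    refine Submodule.eq_of_le_of_finrank_le (Submodule.map_le_iff_le_comap.mpr hA) ?_
    rwa [← (J.equivMapOfInjective A.mulVecLin hAinj).finrank_eq]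
  -- The adjugate inverts `A` up to the scalar `A.det`, which a subspace does not notice.
  have hadj : ∀ y ∈ K, A.adjugate.mulVec y ∈ J := by
    rw [← hAJ]
    rintro _ ⟨x, hx, rfl⟩
    rw [Matrix.mulVecLin_apply, Matrix.mulVec_mulVec, Matrix.adjugate_mul, Matrix.smul_mulVec,
      Matrix.one_mulVec]
    exact J.smul_mem _ hx
  have hpow : ∀ n : ℕ, ∀ x ∈ J, ((A.adjugate * B) ^ n).mulVec x ∈ J := by
    intro n
    induction n with
    | zero => simp
    | succ n ih =>
      intro x hx
      rw [pow_succ, ← Matrix.mulVec_mulVec, ← Matrix.mulVec_mulVec]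
      exact ih _ (hadj _ (hB x hx))
  refine J.eq_bot_or_eq_top_of_forall_mulVec_mem fun N x hx => ?_
  obtain ⟨c, hc⟩ := Matrix.vecMul_surjective_iff_isUnit.mpr
    ((Matrix.isUnit_iff_isUnit_det _).mpr hM.isUnit) fun q : Fin d × Fin d => N q.1 q.2
  have hN : N = ∑ p : Fin d × Fin d, c p •
      ((A.adjugate * B) ^ (p.1 : ℕ) * (A.adjugate * C) * (A.adjugate * B) ^ (p.2 : ℕ)) := by
    ext i j
    simpa [Matrix.vecMul, dotProduct, Matrix.sum_apply] using (congrFun hc (i, j)).symm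
  rw [hN, Matrix.sum_mulVec]
  refine J.sum_mem fun p _ => ?_
  rw [Matrix.smul_mulVec, ← Matrix.mulVec_mulVec, ← Matrix.mulVec_mulVec, ← Matrix.mulVec_mulVec]
  exact J.smul_mem _ (hpow _ _ (hadj _ (hC _ (hpow _ _ hx))))

/-! ### Polynomial functions and Zariski density -/

section Zariski

variable {k W : Type*} [Field k] [AddCommGroup W] [Module k W]

theorem exists_polynomial_eval_eq_on_line {f : W → k} (hf : f ∈ polyFunctionsOn k W) (v w : W) :
    ∃ P : Polynomial k, ∀ t : k, P.eval t = f (v + t • w) := by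
  induction hf using Algebra.adjoin_induction with
  | mem f hf =>
    obtain ⟨φ, rfl⟩ := hf
    exact ⟨Polynomial.C (φ v) + Polynomial.X * Polynomial.C (φ w), fun t => by simp [mul_comm t]⟩
  | algebraMap r => exact ⟨Polynomial.C r, fun t => by simp⟩
  | add f g _ _ hf hg =>
    obtain ⟨P, hP⟩ := hf
    obtain ⟨Q, hQ⟩ := hg
    exact ⟨P + Q, fun t => by simp [hP, hQ]⟩
  | mul f g _ _ hf hg =>
    obtain ⟨P, hP⟩ := hf
    obtain ⟨Q, hQ⟩ := hg
    exact ⟨P * Q, fun t => by simp [hP, hQ]⟩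

/-- On the line through `v` and `w` both functions become nonzero one-variable polynomials, whose
product has a nonroot in an infinite field. This gives density of nonvanishing loci. -/
theorem exists_mul_ne_zero_of_mem_polyFunctionsOn [Infinite k] {f g : W → k}
    (hf : f ∈ polyFunctionsOn k W) (hg : g ∈ polyFunctionsOn k W) {v w : W} (hv : f v ≠ 0)
    (hw : g w ≠ 0) : ∃ u, f u ≠ 0 ∧ g u ≠ 0 := by
  obtain ⟨P, hP⟩ := exists_polynomial_eval_eq_on_line hf v (w - v)
  obtain ⟨Q, hQ⟩ := exists_polynomial_eval_eq_on_line hg v (w - v)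
  have hP0 : P ≠ 0 := by
    rintro rfl
    exact hv (by simpa using (hP 0).symm)
  have hQ0 : Q ≠ 0 := by
    rintro rfl
    exact hw (by simpa using (hQ 1).symm)
  obtain ⟨t, ht⟩ := Polynomial.exists_eval_ne_zero_of_natDegree_lt_card (P * Q)
    (mul_ne_zero hP0 hQ0) (Cardinal.natCast_lt_aleph0.trans_le (Cardinal.aleph0_le_mk k))
  rw [Polynomial.eval_mul, hP, hQ] at ht
  exact ⟨_, left_ne_zero_of_mul ht, right_ne_zero_of_mul ht⟩

theorem HoldsGenerically.of_polyFunction [Infinite k] {p : W → Prop} {f : W → k}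
    (hf : f ∈ polyFunctionsOn k W) {w₀ : W} (hw₀ : f w₀ ≠ 0) (h : ∀ w, f w ≠ 0 → p w) :
    HoldsGenerically k p := by
  let _ := zariskiTopology k W
  refine ⟨{w | f w ≠ 0}, ?_, ?_, h⟩
  · change IsZariskiClosed k _
    exact ⟨{f}, by simpa using hf, by ext; simp [commonZeros]⟩
  · refine dense_iff_inter_open.mpr fun O hO ⟨v, hv⟩ => ?_
    change IsZariskiClosed k _ at hO
    obtain ⟨P, hP, hOP⟩ := hO
    have hmem : ∀ u, u ∈ O ↔ ∃ g ∈ P, g u ≠ 0 := fun u => by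
      rw [← not_iff_not, ← Set.mem_compl_iff, hOP]
      simp [commonZeros]
    obtain ⟨g, hg, hgv⟩ := (hmem v).mp hv
    obtain ⟨u, hgu, hfu⟩ := exists_mul_ne_zero_of_mem_polyFunctionsOn (hP hg) hf hgv hw₀
    exact ⟨u, (hmem u).mpr ⟨g, hg, hgu⟩, hfu⟩

theorem HoldsGenerically.and {p q : W → Prop} (hp : HoldsGenerically k p)
    (hq : HoldsGenerically k q) : HoldsGenerically k fun w => p w ∧ q w := by
  let _ := zariskiTopology k W
  obtain ⟨A, hA, hA', hAp⟩ := hp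
  obtain ⟨B, hB, hB', hBq⟩ := hq
  exact ⟨A ∩ B, hA.inter hB, hA'.inter_of_isOpen_left hB' hA, fun w hw => ⟨hAp w hw.1, hBq w hw.2⟩⟩

/-- Evaluation of polynomial functions at a point. -/
def polyFunctionsEval (w : W) : polyFunctionsOn k W →+* k :=
  (Pi.evalRingHom (fun _ : W => k) w).comp (polyFunctionsOn k W).val.toRingHom

/-- A linear form as a polynomial function. -/
def linearPolyFunction (φ : Module.Dual k W) : polyFunctionsOn k W :=
  ⟨φ, Algebra.subset_adjoin ⟨φ, rfl⟩⟩

end Zariski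

/-! ### Isotopes and generic multiplication laws -/

section Algebras

variable {k V : Type*} [Field k] [AddCommGroup V] [Module k V]

theorem AreIsotopic.flip {m₁ m₂ : MultiplicationLaw k V} (h : AreIsotopic m₁ m₂) :
    AreIsotopic m₁.flip m₂.flip := by
  obtain ⟨f₁, f₂, f₃, h⟩ := h
  exact ⟨f₁, f₃, f₂, fun x y => h y x⟩

theorem IsIsotopicallyLeftSimple.of_flip {m : MultiplicationLaw k V}
    (h : IsIsotopicallyLeftSimple (LinearMap.flip m)) : IsIsotopicallyRightSimple m :=
  fun m' hm' I hI => h m'.flip hm'.flip I hI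

/-- For a left ideal `I` of the isotope, take `J` and `K` to be the preimages of `I` under `f₃` and
`f₁`. -/
theorem isIsotopicallyLeftSimple_of_forall_submodule [FiniteDimensional k V]
    {m : MultiplicationLaw k V}
    (h : ∀ J K : Submodule k V, Module.finrank k K ≤ Module.finrank k J →
      (∀ v, ∀ x ∈ J, m v x ∈ K) → J = ⊥ ∨ J = ⊤) : IsIsotopicallyLeftSimple m := by
  rintro m' ⟨f₁, f₂, f₃, hf⟩ I hI
  have key := h (I.map f₃.symm.toLinearMap) (I.map f₁.symm.toLinearMap)
    (by rw [LinearEquiv.finrank_map_eq, LinearEquiv.finrank_map_eq]) (by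
      rintro v _ ⟨y, hy, rfl⟩
      refine ⟨m' (f₂ v) y, hI _ _ hy, ?_⟩
      have := hf v (f₃.symm y)
      rw [LinearEquiv.apply_symm_apply] at this
      simp [← this])
  rcases key with key | key
  · exact .inl (Submodule.map_injective_of_injective f₃.symm.injective
      (by rw [key, Submodule.map_bot]))
  · refine .inr (Submodule.map_injective_of_injective f₃.symm.injective ?_)
    rw [key, Submodule.map_top, LinearEquiv.range]

theorem isIsotopicallyLeftSimple_of_wordDet_ne_zero {d : ℕ} (b : Module.Basis (Fin d) k V)
    {m : MultiplicationLaw k V} (u v w : V)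
    (h : wordDet (LinearMap.toMatrix b b (m u)) (LinearMap.toMatrix b b (m v))
      (LinearMap.toMatrix b b (m w)) ≠ 0) : IsIsotopicallyLeftSimple m := by
  have : FiniteDimensional k V := b.finiteDimensional_of_finite
  refine isIsotopicallyLeftSimple_of_forall_submodule fun J K hJK hm => ?_
  have hmem : ∀ z, ∀ x ∈ J.map b.equivFun.toLinearMap,
      (LinearMap.toMatrix b b (m z)).mulVec x ∈ K.map b.equivFun.toLinearMap := by
    rintro z _ ⟨x, hx, rfl⟩
    refine ⟨m z x, hm z x hx, ?_⟩
    exact (LinearMap.toMatrix_mulVec_repr b b (m z) x).symm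
  rcases Submodule.eq_bot_or_eq_top_of_wordDet_ne_zero h _ _
    (by rwa [LinearEquiv.finrank_map_eq, LinearEquiv.finrank_map_eq])
    (hmem u) (hmem v) (hmem w) with key | key
  · exact .inl (Submodule.map_injective_of_injective b.equivFun.injective
      (by rw [key, Submodule.map_bot]))
  · refine .inr (Submodule.map_injective_of_injective b.equivFun.injective ?_)
    rw [key, Submodule.map_top, LinearEquiv.range]

/-- The matrix of polynomial functions whose entries are those of a matrix depending linearly on
a point. -/
def genericMatrix {W : Type*} [AddCommGroup W] [Module k W] {d : ℕ}
    (L : W →ₗ[k] Matrix (Fin d) (Fin d) k) : Matrix (Fin d) (Fin d) (polyFunctionsOn k W) :=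
  Matrix.of fun i j => linearPolyFunction (Matrix.entryLinearMap k k i j ∘ₗ L)

/-- Form `wordDet` over the ring of polynomial functions; evaluation at a point is a ring
homomorphism, so it commutes with `wordDet`. -/
theorem wordDet_linear_mem_polyFunctionsOn {W : Type*} [AddCommGroup W] [Module k W] {d : ℕ}
    (A B C : W →ₗ[k] Matrix (Fin d) (Fin d) k) :
    (fun w => wordDet (A w) (B w) (C w)) ∈ polyFunctionsOn k W := by
  have : (fun w => wordDet (A w) (B w) (C w)) =
      (wordDet (genericMatrix A) (genericMatrix B) (genericMatrix C) : polyFunctionsOn k W) := by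
    funext w
    exact (map_wordDet (polyFunctionsEval w) (genericMatrix A) (genericMatrix B)
      (genericMatrix C)).symm
  rw [this]
  exact Subtype.property _

theorem exists_multiplicationLaw_wordDet_ne_zero [CharZero k] {d : ℕ}
    (b : Module.Basis (Fin d) k V) {i₀ i₁ i₂ : Fin d} (h₁ : i₁ ≠ i₀) (h₂ : i₂ ≠ i₀)
    (h₃ : i₂ ≠ i₁) :
    ∃ m : MultiplicationLaw k V, wordDet (LinearMap.toMatrix b b (m (b i₀)))
      (LinearMap.toMatrix b b (m (b i₁))) (LinearMap.toMatrix b b (m (b i₂))) ≠ 0 := by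
  refine ⟨b.constr k fun i => Matrix.toLin b b (if i = i₀ then 1 else if i = i₁ then
    Matrix.diagonal fun i => ((i : ℕ) : k) else Matrix.of fun _ _ => 1), ?_⟩
  simp only [Module.Basis.constr_basis, LinearMap.toMatrix_toLin, if_true, if_neg h₁, if_neg h₂,
    if_neg h₃]
  exact wordDet_one_diagonal_ne_zero d

/-- The twist `e` serves both sides at once: the identity gives left-simplicity, the flip gives
right-simplicity. -/
theorem holdsGenerically_isIsotopicallyLeftSimple_comp [CharZero k] {d : ℕ} (hd : 3 ≤ d)
    (b : Module.Basis (Fin d) k V) (e : MultiplicationLaw k V ≃ₗ[k] MultiplicationLaw k V) :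
    HoldsGenerically k fun m : MultiplicationLaw k V => IsIsotopicallyLeftSimple (e m) := by
  let L (v : V) : MultiplicationLaw k V →ₗ[k] Matrix (Fin d) (Fin d) k :=
    (LinearMap.toMatrix b b).toLinearMap ∘ₗ LinearMap.applyₗ v ∘ₗ e.toLinearMap
  obtain ⟨m₀, hm₀⟩ := exists_multiplicationLaw_wordDet_ne_zero b
    (i₀ := ⟨0, by omega⟩) (i₁ := ⟨1, by omega⟩) (i₂ := ⟨2, by omega⟩)
    (by simp) (by simp) (by simp)
  refine .of_polyFunction
    (wordDet_linear_mem_polyFunctionsOn (L (b ⟨0, by omega⟩)) (L (b ⟨1, by omega⟩))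
      (L (b ⟨2, by omega⟩))) (w₀ := e.symm m₀) ?_
    fun m hm => isIsotopicallyLeftSimple_of_wordDet_ne_zero b _ _ _ hm
  simpa [L] using hm₀

theorem submodule_eq_bot_or_eq_top_of_finrank_le_one [FiniteDimensional k V]
    (h : Module.finrank k V ≤ 1) (I : Submodule k V) : I = ⊥ ∨ I = ⊤ := by
  rcases Nat.eq_zero_or_pos (Module.finrank k I) with hI | hI
  · exact .inl (Submodule.finrank_eq_zero.mp hI)
  · exact .inr (Submodule.eq_top_of_finrank_eq (le_antisymm I.finrank_le (h.trans hI)))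

end Algebras

theorem mainTheorem7 {k V : Type*} [Field k] [IsAlgClosed k] [CharZero k]
    [AddCommGroup V] [Module k V] [FiniteDimensional k V] (hd : Module.finrank k V ≠ 2) :
    HoldsGenerically k (fun m : MultiplicationLaw k V =>
      IsIsotopicallyLeftSimple m ∧ IsIsotopicallyRightSimple m) := by
  rcases le_or_gt (Module.finrank k V) 1 with h | h
  -- The constant function 1 makes the open set all of the space of laws.
  · exact .of_polyFunction (one_mem _) (w₀ := 0) one_ne_zero fun m _ =>
      ⟨fun _ _ I _ => submodule_eq_bot_or_eq_top_of_finrank_le_one h I,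
        fun _ _ I _ => submodule_eq_bot_or_eq_top_of_finrank_le_one h I⟩
  · have hd3 : 3 ≤ Module.finrank k V := by omega
    have b := Module.finBasis k V
    refine (holdsGenerically_isIsotopicallyLeftSimple_comp hd3 b (.refl k _)).and ?_
    obtain ⟨U, hU, hU', h⟩ := holdsGenerically_isIsotopicallyLeftSimple_comp hd3 b
      (LinearMap.lflip : MultiplicationLaw k V ≃ₗ[k] MultiplicationLaw k V)
    exact ⟨U, hU, hU', fun m hm => IsIsotopicallyLeftSimple.of_flip (h m hm)⟩
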